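/- For a real-valued random variable $X$ with characteristic function $f_X(s)=\mathbb{E}\,e^{isX}$, let $$\mathcal{V}^2(X)=\frac{1}{\pi^2}\int_{\mathbb{R}^2}\frac{|f_X(s+t)-f_X(s)f_X(t)|^2}{s^2\,t^2}\,ds\,dt\in[0,\infty]$$ be its distance variance, and let the distance standard deviation $\mathcal{V}(X)\in[0,\infty]$ be the nonnegative square root of $\mathcal{V}^2(X)$. For real-valued random variables $X$ and $Y$ (possibly defined on different probability spaces) with distribution functions $F$ and $G$ and right-continuous inverses $F^{-1}(\alpha)=\inf\{x:F(x)>\alpha\}$ and $G^{-1}(\alpha)=\inf\{x:G(x)>\alpha\}$, write $X\le_{\rm disp}Y$ ($X$ is smaller than $Y$ in the dispersive order) if $$F^{-1}(\beta)-F^{-1}(\alpha)\le G^{-1}(\beta)-G^{-1}(\alpha)\qquad\text{for all } 0<\alpha\le\beta<1.$$ If $X\le_{\rm disp}Y$, then $\mathcal{V}(X)\le\mathcal{V}(Y)$. Consequently, $\mathcal{V}$ is a measure of spread in the sense of Bickel and Lehmann, i.e. it satisfies, for all real-valued random variables $X$ and $Y$: (C1) $\mathcal{V}(X)\ge 0$;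 (C2) $\mathcal{V}(a+bX)=|b|\,\mathcal{V}(X)$ for all $a,b\in\mathbb{R}$ (with $0\cdot\infty=0$); (C3) $\mathcal{V}(X)\le\mathcal{V}(Y)$ whenever $X\le_{\rm disp}Y$. -/

import Mathlib

open MeasureTheory ProbabilityTheory
open scoped ENNReal

universe u v

/-- The right-continuous inverse `F⁻¹(α) = inf {x : F(x) > α}` of a distribution function `F`.
For `0 < α < 1` the infimum is over a non-empty set that is bounded below. -/
noncomputable def rightContInverse (F : ℝ → ℝ) (α : ℝ) : ℝ :=
  sInf {x : ℝ | α < F x}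

/-- The dispersive order `X ≤_disp Y` for real random variables `X` on `(Ω, μ)` and `Y` on
`(Ω', ν)`: with `F`, `G` the distribution functions of `X`, `Y`,
`F⁻¹(β) - F⁻¹(α) ≤ G⁻¹(β) - G⁻¹(α)` for all `0 < α ≤ β < 1`. -/
def DispersiveLE {Ω : Type u} {Ω' : Type v} [MeasurableSpace Ω] [MeasurableSpace Ω']
    (μ : Measure Ω) (X : Ω → ℝ) (ν : Measure Ω') (Y : Ω' → ℝ) : Prop :=
  ∀ α β : ℝ, 0 < α → α ≤ β → β < 1 →
    rightContInverse (cdf (μ.map X)) β - rightContInverse (cdf (μ.map X)) α ≤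
      rightContInverse (cdf (ν.map Y)) β - rightContInverse (cdf (ν.map Y)) α

/-- The distance variance of a real random variable `X` with characteristic function `f`,
`𝒱²(X) = π⁻² ∫∫ |f(s + t) - f(s) f(t)|² / (|s|² |t|²) ds dt`,
as an element of `[0, ∞]` (the integrand is nonnegative). -/
noncomputable def distVariance {Ω : Type u} [MeasurableSpace Ω] (μ : Measure Ω) (X : Ω → ℝ) :
    ℝ≥0∞ :=
  ENNReal.ofReal (1 / Real.pi ^ 2) *
    ∫⁻ p : ℝ × ℝ, ENNReal.ofReal
      (‖charFun (μ.map X) (p.1 + p.2) - charFun (μ.map X) p.1 * charFun (μ.map X) p.2‖ ^ 2 /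
        (|p.1| ^ 2 * |p.2| ^ 2))

/-- The distance standard deviation `𝒱(X)`: the nonnegative square root of `𝒱²(X)`. -/
noncomputable def distStdDev {Ω : Type u} [MeasurableSpace Ω] (μ : Measure Ω) (X : Ω → ℝ) :
    ℝ≥0∞ :=
  distVariance μ X ^ (1 / 2 : ℝ)

/-- A functional `τ` of real random variables, with values in the extended reals, is a measure of
spread in the sense of Bickel and Lehmann if it satisfies the axioms (C1)-(C3).
In (C2) the convention `0 * ∞ = 0` is used. -/
structure IsMeasureOfSpread
    (τ : ∀ (Ω : Type u) [MeasurableSpace Ω], Measure Ω → (Ω → ℝ) → EReal) : Prop where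
  /-- (C1) `τ(X) ≥ 0`. -/
  nonneg : ∀ (Ω : Type u) [MeasurableSpace Ω] (μ : Measure Ω) [IsProbabilityMeasure μ]
    (X : Ω → ℝ), AEMeasurable X μ → 0 ≤ τ Ω μ X
  /-- (C2) `τ(a + bX) = |b| τ(X)`. -/
  dilation : ∀ (Ω : Type u) [MeasurableSpace Ω] (μ : Measure Ω) [IsProbabilityMeasure μ]
    (X : Ω → ℝ), AEMeasurable X μ → ∀ a b : ℝ,
      τ Ω μ (fun ω => a + b * X ω) = ((|b| : ℝ) : EReal) * τ Ω μ X
  /-- (C3) `τ(X) ≤ τ(Y)` if `X ≤_disp Y`. -/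
  mono : ∀ (Ω Ω' : Type u) [MeasurableSpace Ω] [MeasurableSpace Ω']
    (μ : Measure Ω) (ν : Measure Ω') [IsProbabilityMeasure μ] [IsProbabilityMeasure ν]
    (X : Ω → ℝ) (Y : Ω' → ℝ), AEMeasurable X μ → AEMeasurable Y ν →
      DispersiveLE μ X ν Y → τ Ω μ X ≤ τ Ω' ν Y

/-! Everything rests on a formula without characteristic functions, valid in `[0, ∞]` with no moment
assumption: the distance variance is the mean of `|I ∩ J|²`, where `I` and `J` are the intervals
spanned by two independent pairs of copies of `X` (`distVariance_eq_lintegral_overlap`).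

Given the formula, monotonicity is pointwise. Realise `X` and `Y` as `F⁻¹(U)` and `G⁻¹(U)` with the
same four uniform variables. Monotone maps send endpoints to endpoints, so both overlaps are
increments of `F⁻¹` and `G⁻¹` between the same two levels, and the dispersive order compares exactly
such increments (`overlap_mapFour_le`). Scaling of the overlap gives (C2).

For the formula, `f(s+t) - f(s) f(t)` is half the mean of a product of increments `(exp(isX) -
exp(isX'))(exp(itX) - exp(itX'))`. Its squared modulus involves two independent pairs. Integrated
against a product weight in `(s, t)`, it factorises for fixed pairs into the square of a double
difference of the Fourier transform of the weight (`integral_normSq_charCov`). The weight `1 / s²`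
is not integrable, so it is replaced by `1 / (s² + γ²)`, a multiple of a Cauchy density; its
transform is, up to constants, `(1 - exp(-γ|x|)) / γ`, which tends to `|x|`. The double difference
of `|x|` is, up to sign, `2 |I ∩ J|`. The limit `γ → 0` is taken by Fatou's lemma in each direction,
one of them after truncating `X`. -/

/-! ### Characteristic function of the Cauchy distribution -/

section CauchyCharFun

open Complex FourierTransform Set

lemma integrable_exp_neg_mul_abs {c : ℝ} (hc : 0 < c) :
    Integrable (fun x : ℝ => ((Real.exp (-c * |x|) : ℝ) : ℂ)) := by
  have h : Integrable (fun x : ℝ => Real.exp (-c * |x|)) := by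
    rw [← integrableOn_univ, ← Iic_union_Ioi (a := (0 : ℝ)), integrableOn_union]
    constructor
    · refine (integrableOn_exp_mul_Iic hc 0).congr_fun (fun x hx => ?_) measurableSet_Iic
      simp [abs_of_nonpos (show x ≤ 0 from hx)]
    · refine (integrableOn_exp_mul_Ioi (neg_lt_zero.2 hc) 0).congr_fun (fun x hx => ?_)
        measurableSet_Ioi
      simp [abs_of_pos (show 0 < x from hx)]
  exact h.ofReal

lemma fourier_exp_neg_mul_abs {c : ℝ} (hc : 0 < c) (w : ℝ) :
    𝓕 (fun x : ℝ => ((Real.exp (-c * |x|) : ℝ) : ℂ)) w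
      = ((2 * c / (c ^ 2 + (2 * Real.pi * w) ^ 2) : ℝ) : ℂ) := by
  rw [Real.fourier_eq']
  have hint : Integrable (fun x : ℝ =>
      cexp (((-2 * Real.pi * inner ℝ x w : ℝ) : ℂ) * I) • ((Real.exp (-c * |x|) : ℝ) : ℂ)) := by
    refine (integrable_exp_neg_mul_abs hc).mono ?_ ?_
    · exact Continuous.aestronglyMeasurable (by fun_prop)
    · refine Filter.Eventually.of_forall fun x => ?_
      rw [norm_smul, Complex.norm_exp_ofReal_mul_I, one_mul]
  rw [← integral_add_compl measurableSet_Iic hint (s := Iic 0), compl_Iic]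
  have h1 : ∫ x in Iic (0 : ℝ), cexp (((-2 * Real.pi * inner ℝ x w : ℝ) : ℂ) * I)
      • ((Real.exp (-c * |x|) : ℝ) : ℂ)
      = ∫ x in Iic (0 : ℝ), cexp ((c - 2 * Real.pi * w * I : ℂ) * x) := by
    refine setIntegral_congr_fun measurableSet_Iic fun x hx => ?_
    simp only [smul_eq_mul, ofReal_exp, ← Complex.exp_add, abs_of_nonpos (show x ≤ 0 from hx)]
    congr 1
    simp
    ring
  have h2 : ∫ x in Ioi (0 : ℝ), cexp (((-2 * Real.pi * inner ℝ x w : ℝ) : ℂ) * I)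
      • ((Real.exp (-c * |x|) : ℝ) : ℂ)
      = ∫ x in Ioi (0 : ℝ), cexp ((-(c + 2 * Real.pi * w * I) : ℂ) * x) := by
    refine setIntegral_congr_fun measurableSet_Ioi fun x hx => ?_
    simp only [smul_eq_mul, ofReal_exp, ← Complex.exp_add, abs_of_pos (show 0 < x from hx)]
    congr 1
    simp
    ring
  have e1 : (c - 2 * Real.pi * w * I : ℂ) ≠ 0 := fun h => by
    have := congrArg re h
    simp at this
    exact hc.ne' this
  have e2 : (c + 2 * Real.pi * w * I : ℂ) ≠ 0 := fun h => by
    have := congrArg re h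
    simp at this
    exact hc.ne' this
  have e3 : ((c ^ 2 + (2 * Real.pi * w) ^ 2 : ℂ)) ≠ 0 := by
    have : (0 : ℝ) < c ^ 2 + (2 * Real.pi * w) ^ 2 := by positivity
    exact_mod_cast this.ne'
  rw [h1, h2, integral_exp_mul_complex_Iic (by simpa using hc),
    integral_exp_mul_complex_Ioi (by simpa using hc)]
  push_cast
  simp only [mul_zero, Complex.exp_zero, neg_div_neg_eq]
  rw [div_add_div _ _ e1 e2, div_eq_div_iff (mul_ne_zero e1 e2) e3]
  linear_combination (2 * c * (2 * Real.pi * w) ^ 2 : ℂ) * I_sq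

/-- The characteristic function of the centred Cauchy distribution. -/
lemma charFun_cauchyMeasure_zero {γ : NNReal} (hγ : γ ≠ 0) (s : ℝ) :
    charFun (cauchyMeasure 0 γ) s = ((Real.exp (-γ * |s|) : ℝ) : ℂ) := by
  have hγ' : (0 : ℝ) < γ := lt_of_le_of_ne γ.2 (by exact_mod_cast hγ.symm)
  have hpi := Real.pi_pos
  have hc : 0 < 2 * Real.pi * (γ : ℝ) := by positivity
  -- The rate `2πγ` absorbs the `2π` in the normalisation of `𝓕`, so that the transform is exactly
  -- the Cauchy density; inversion is then evaluated at `s / (2π)`.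
  have hF : 𝓕 (fun x : ℝ => ((Real.exp (-(2 * Real.pi * γ) * |x|) : ℝ) : ℂ))
      = fun w => ((cauchyPDFReal 0 γ w : ℝ) : ℂ) := by
    funext w
    rw [fourier_exp_neg_mul_abs hc, cauchyPDFReal_def]
    congr 1
    have : (0 : ℝ) < w ^ 2 + γ ^ 2 := by positivity
    have h3 : (2 * Real.pi * (γ : ℝ)) ^ 2 + (2 * Real.pi * w) ^ 2
      = 4 * Real.pi ^ 2 * (w ^ 2 + γ ^ 2) := by ring
    rw [h3, sub_zero]
    field_simp
    ring
  have hinv := Continuous.fourierInv_fourier_eq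
    (f := fun x : ℝ => ((Real.exp (-(2 * Real.pi * γ) * |x|) : ℝ) : ℂ)) (by fun_prop)
    (integrable_exp_neg_mul_abs hc) (by rw [hF]; exact (integrable_cauchyPDFReal 0).ofReal)
  have h := congrFun hinv (s / (2 * Real.pi))
  rw [hF, Real.fourierInv_eq'] at h
  have e : -(2 * Real.pi * (γ : ℝ)) * |s / (2 * Real.pi)| = -γ * |s| := by
    rw [abs_div, abs_of_pos (show 0 < 2 * Real.pi by positivity)]
    field_simp
  simp only [e] at h
  rw [← h, charFun_apply_real, cauchyMeasure_of_scale_ne_zero 0 hγ,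
    integral_withDensity_eq_integral_toReal_smul (by fun_prop)
      (Filter.Eventually.of_forall fun x => by simp [cauchyPDF])]
  refine integral_congr_ae (Filter.Eventually.of_forall fun x => ?_)
  simp only [cauchyPDF, ENNReal.toReal_ofReal (cauchyPDF_pos 0 hγ x).le, smul_eq_mul,
    Complex.real_smul]
  rw [mul_comm]
  congr 2
  simp
  field_simp

end CauchyCharFun

/-! ### Covariances of exponentials and double differences -/

/-- The double difference `κ(p₁ - q₁) + κ(p₂ - q₂) - κ(p₁ - q₂) - κ(p₂ - q₁)`. -/
noncomputable def doubleDiff (κ : ℝ → ℝ) (z : (ℝ × ℝ) × (ℝ × ℝ)) : ℝ :=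
  κ (z.1.1 - z.2.1) + κ (z.1.2 - z.2.2) - κ (z.1.1 - z.2.2) - κ (z.1.2 - z.2.1)

/-- The covariance `f(s + t) - f(s) f(t)` of `exp(isX)` and `exp(-itX)`. -/
noncomputable def charCov (P : Measure ℝ) (s t : ℝ) : ℂ :=
  charFun P (s + t) - charFun P s * charFun P t

/-- The law of two independent pairs of independent copies. -/
noncomputable abbrev fourCopies (P : Measure ℝ) : Measure ((ℝ × ℝ) × (ℝ × ℝ)) :=
  (P.prod P).prod (P.prod P)

section Fubini

open Complex ComplexConjugate

/-- The increment `exp(isp₁) - exp(isp₂)`. -/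
noncomputable def expDiff (s : ℝ) (p : ℝ × ℝ) : ℂ :=
  cexp (s * p.1 * I) - cexp (s * p.2 * I)

@[fun_prop]
lemma Continuous.expDiff {α : Type*} [TopologicalSpace α] {f : α → ℝ} {g : α → ℝ × ℝ}
    (hf : Continuous f) (hg : Continuous g) : Continuous fun a => expDiff (f a) (g a) := by
  unfold _root_.expDiff
  fun_prop

lemma norm_cexp_mul_I (s x : ℝ) : ‖cexp (s * x * I)‖ = 1 := by
  rw [← ofReal_mul, norm_exp_ofReal_mul_I]

lemma norm_expDiff_le (s : ℝ) (p : ℝ × ℝ) : ‖expDiff s p‖ ≤ 2 := by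
  refine (norm_sub_le _ _).trans ?_
  rw [norm_cexp_mul_I, norm_cexp_mul_I]
  norm_num

lemma integrable_of_continuous_of_bound {α : Type*} [TopologicalSpace α] [MeasurableSpace α]
    [OpensMeasurableSpace α] [SecondCountableTopology α] {μ : Measure α} [IsFiniteMeasure μ]
    {f : α → ℂ} (hf : Continuous f) (C : ℝ) (hC : ∀ a, ‖f a‖ ≤ C) : Integrable f μ :=
  Integrable.of_bound hf.aestronglyMeasurable C (Filter.Eventually.of_forall hC)

/-- Symmetrisation: the two diagonal products each have mean `f(s + t)`, and by independence the two
cross products each have mean `f(s) f(t)`. -/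
lemma integral_expDiff_mul_expDiff (P : Measure ℝ) [IsProbabilityMeasure P] (s t : ℝ) :
    ∫ p, expDiff s p * expDiff t p ∂(P.prod P) = 2 * charCov P s t := by
  have e (p : ℝ × ℝ) : expDiff s p * expDiff t p =
      (cexp (((s + t : ℝ) : ℂ) * p.1 * I) * 1 + 1 * cexp (((s + t : ℝ) : ℂ) * p.2 * I))
      - (cexp (s * p.1 * I) * cexp (t * p.2 * I) + cexp (t * p.1 * I) * cexp (s * p.2 * I)) := by
    have h (x : ℝ) : cexp (((s + t : ℝ) : ℂ) * x * I) = cexp (s * x * I) * cexp (t * x * I) := by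
      rw [← Complex.exp_add]
      congr 1
      push_cast
      ring
    rw [h, h, expDiff, expDiff]
    ring
  simp_rw [e]
  have b (s t : ℝ) (p : ℝ × ℝ) : ‖cexp (s * p.1 * I) * cexp (t * p.2 * I)‖ ≤ 1 := by
    rw [norm_mul, norm_cexp_mul_I, norm_cexp_mul_I, one_mul]
  have i1 : Integrable (fun p : ℝ × ℝ => cexp (((s + t : ℝ) : ℂ) * p.1 * I) * 1) (P.prod P) :=
    integrable_of_continuous_of_bound (by fun_prop) 1 fun p => by
      rw [mul_one, norm_cexp_mul_I]
  have i2 : Integrable (fun p : ℝ × ℝ => 1 * cexp (((s + t : ℝ) : ℂ) * p.2 * I)) (P.prod P) :=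
    integrable_of_continuous_of_bound (by fun_prop) 1 fun p => by
      rw [one_mul, norm_cexp_mul_I]
  have i3 (s t : ℝ) :
      Integrable (fun p : ℝ × ℝ => cexp (s * p.1 * I) * cexp (t * p.2 * I)) (P.prod P) :=
    integrable_of_continuous_of_bound (by fun_prop) 1 (b s t)
  have i4 : Integrable (fun p : ℝ × ℝ => cexp (((s + t : ℝ) : ℂ) * p.1 * I) * 1
      + 1 * cexp (((s + t : ℝ) : ℂ) * p.2 * I)) (P.prod P) := i1.add i2
  have i5 : Integrable (fun p : ℝ × ℝ => cexp (s * p.1 * I) * cexp (t * p.2 * I)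
      + cexp (t * p.1 * I) * cexp (s * p.2 * I)) (P.prod P) := (i3 s t).add (i3 t s)
  rw [integral_sub i4 i5, integral_add i1 i2,
    integral_add (i3 s t) (i3 t s), integral_prod_mul (fun x : ℝ => cexp (s * x * I))
      (fun x : ℝ => cexp (t * x * I)),
    integral_prod_mul (fun x : ℝ => cexp (t * x * I)) (fun x : ℝ => cexp (s * x * I)),
    integral_prod_mul (fun x : ℝ => cexp (((s + t : ℝ) : ℂ) * x * I)) (fun _ : ℝ => 1),
    integral_prod_mul (fun _ : ℝ => 1) (fun x : ℝ => cexp (((s + t : ℝ) : ℂ) * x * I))]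
  simp only [← charFun_apply_real, charCov]
  simp
  ring

lemma integral_expDiff_mul_conj (C : Measure ℝ) [IsProbabilityMeasure C] {κ : ℝ → ℝ}
    (hκ : ∀ s, charFun C s = κ s) (z : (ℝ × ℝ) × (ℝ × ℝ)) :
    ∫ s, expDiff s z.1 * conj (expDiff s z.2) ∂C = doubleDiff κ z := by
  have e (s : ℝ) : expDiff s z.1 * conj (expDiff s z.2) =
      (cexp (((z.1.1 - z.2.1 : ℝ) : ℂ) * s * I) + cexp (((z.1.2 - z.2.2 : ℝ) : ℂ) * s * I))
      - cexp (((z.1.1 - z.2.2 : ℝ) : ℂ) * s * I) - cexp (((z.1.2 - z.2.1 : ℝ) : ℂ) * s * I) := by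
    have h (x y : ℝ) : cexp (((x - y : ℝ) : ℂ) * s * I)
        = cexp (s * x * I) * cexp (- (s * y * I)) := by
      rw [← Complex.exp_add]
      congr 1
      push_cast
      ring
    have h' (y : ℝ) : conj (cexp (s * y * I)) = cexp (- (s * y * I)) := by
      rw [← Complex.exp_conj]
      simp
    simp only [h, expDiff, map_sub, h']
    ring
  simp_rw [e]
  have i (a : ℝ) : Integrable (fun s : ℝ => cexp (a * s * I)) C :=
    integrable_of_continuous_of_bound (by fun_prop) 1 fun p => by rw [norm_cexp_mul_I]
  have i2 (a b : ℝ) : Integrable (fun s : ℝ => cexp (a * s * I) + cexp (b * s * I)) C :=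
    (i a).add (i b)
  have i3 (a b c : ℝ) : Integrable
      (fun s : ℝ => cexp (a * s * I) + cexp (b * s * I) - cexp (c * s * I)) C :=
    (i2 a b).sub (i c)
  rw [integral_sub (i3 _ _ _) (i _), integral_sub (i2 _ _) (i _), integral_add (i _) (i _)]
  simp only [← charFun_apply_real, hκ, doubleDiff]
  push_cast
  rfl

/-- In `|w|² = w * conj w` the second factor is computed with an independent pair, which makes the
square a single expectation, ready for Fubini. -/
lemma four_mul_normSq_charCov (P : Measure ℝ) [IsProbabilityMeasure P] (s t : ℝ) :
    ((4 * ‖charCov P s t‖ ^ 2 : ℝ) : ℂ) =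
      ∫ z, (expDiff s z.1 * expDiff t z.1) * conj (expDiff s z.2 * expDiff t z.2)
        ∂(fourCopies P) := by
  rw [integral_prod_mul (fun p => expDiff s p * expDiff t p)
    (fun q => conj (expDiff s q * expDiff t q)), integral_conj, integral_expDiff_mul_expDiff,
    Complex.mul_conj, Complex.normSq_eq_norm_sq, norm_mul]
  congr 1
  norm_num
  ring

/-- For a probability measure `C` with real characteristic function `κ`, the mean square of the
covariance function of `P` is a quadratic functional of `κ`. -/
lemma integral_normSq_charCov (P C : Measure ℝ) [IsProbabilityMeasure P] [IsProbabilityMeasure C]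
    {κ : ℝ → ℝ} (hκ : ∀ s, charFun C s = κ s) :
    ∫ p, 4 * ‖charCov P p.1 p.2‖ ^ 2 ∂(C.prod C) = ∫ z, doubleDiff κ z ^ 2 ∂(fourCopies P) := by
  have key : ∫ p, ((4 * ‖charCov P p.1 p.2‖ ^ 2 : ℝ) : ℂ) ∂(C.prod C)
      = ∫ z, ((doubleDiff κ z ^ 2 : ℝ) : ℂ) ∂(fourCopies P) := by
    simp_rw [four_mul_normSq_charCov]
    rw [integral_integral_swap]
    · refine integral_congr_ae (Filter.Eventually.of_forall fun z => ?_)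
      -- For fixed `z` the variables `s` and `t` separate into two identical factors, whence the
      -- square.
      have e (p : ℝ × ℝ) : (expDiff p.1 z.1 * expDiff p.2 z.1)
          * conj (expDiff p.1 z.2 * expDiff p.2 z.2)
          = (expDiff p.1 z.1 * conj (expDiff p.1 z.2))
            * (expDiff p.2 z.1 * conj (expDiff p.2 z.2)) := by
        rw [map_mul]
        ring
      simp_rw [e]
      rw [integral_prod_mul (fun s => expDiff s z.1 * conj (expDiff s z.2))
        (fun s => expDiff s z.1 * conj (expDiff s z.2)), integral_expDiff_mul_conj C hκ]
      push_cast
      ring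
    · refine integrable_of_continuous_of_bound
        (by simp only [Function.uncurry_def]; fun_prop) 16 fun a => ?_
      simp only [Function.uncurry_def, norm_mul, RCLike.norm_conj]
      have h1 := norm_expDiff_le a.1.1 a.2.1
      have h2 := norm_expDiff_le a.1.2 a.2.1
      have h3 := norm_expDiff_le a.1.1 a.2.2
      have h4 := norm_expDiff_le a.1.2 a.2.2
      calc _ ≤ ((2 : ℝ) * 2) * (2 * 2) := by gcongr
        _ = 16 := by norm_num
  rw [integral_complex_ofReal, integral_complex_ofReal] at key
  exact_mod_cast key

end Fubini

/-! ### Overlap of two random intervals -/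

/-- The length of the intersection of the intervals spanned by the pairs `z.1` and `z.2`. -/
noncomputable def overlap (z : (ℝ × ℝ) × (ℝ × ℝ)) : ℝ :=
  max 0 (min (max z.1.1 z.1.2) (max z.2.1 z.2.2) - max (min z.1.1 z.1.2) (min z.2.1 z.2.2))

lemma overlap_nonneg (z : (ℝ × ℝ) × (ℝ × ℝ)) : 0 ≤ overlap z := le_max_left _ _

lemma continuous_overlap : Continuous overlap := by
  unfold overlap
  fun_prop

/-- Apply a function to all four coordinates. -/
def mapFour {α β : Type*} (f : α → β) (z : (α × α) × (α × α)) : (β × β) × (β × β) :=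
  Prod.map (Prod.map f f) (Prod.map f f) z

/-- Both sides are piecewise linear in the endpoints, so each ordering of the four points is a
linear check. The sign of the double difference records whether the two pairs have the same
orientation. -/
lemma abs_doubleDiff_abs (z : (ℝ × ℝ) × (ℝ × ℝ)) :
    |doubleDiff (fun x => |x|) z| = 2 * overlap z := by
  obtain ⟨⟨a, b⟩, c, d⟩ := z
  simp only [doubleDiff, overlap]
  rcases le_total a b with h1 | h1 <;> rcases le_total c d with h2 | h2 <;>
  rcases le_total a c with h3 | h3 <;> rcases le_total a d with h4 | h4 <;>
  rcases le_total b c with h5 | h5 <;> rcases le_total b d with h6 | h6 <;>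
  grind

lemma doubleDiff_abs_sq (z : (ℝ × ℝ) × (ℝ × ℝ)) :
    doubleDiff (fun x => |x|) z ^ 2 = 4 * overlap z ^ 2 := by
  rw [← sq_abs, abs_doubleDiff_abs]
  ring

/-- A function with smaller increments than another one decreases the overlap. -/
lemma overlap_mapFour_le {s : Set ℝ} {f g : ℝ → ℝ} (hf : MonotoneOn f s) (hg : MonotoneOn g s)
    (h : ∀ a ∈ s, ∀ b ∈ s, a ≤ b → f b - f a ≤ g b - g a) (z : (ℝ × ℝ) × (ℝ × ℝ))
    (hz : z ∈ (s ×ˢ s) ×ˢ (s ×ˢ s)) : overlap (mapFour f z) ≤ overlap (mapFour g z) := by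
  obtain ⟨⟨a, b⟩, c, d⟩ := z
  obtain ⟨⟨ha, hb⟩, hc, hd⟩ := hz
  simp only at ha hb hc hd
  have hmax {x y : ℝ} (hx : x ∈ s) (hy : y ∈ s) : max x y ∈ s := by
    rcases max_choice x y with e | e <;> rwa [e]
  have hmin {x y : ℝ} (hx : x ∈ s) (hy : y ∈ s) : min x y ∈ s := by
    rcases min_choice x y with e | e <;> rwa [e]
  -- Monotone maps commute with `max` and `min`: the overlap of the images is an increment of `k`
  -- between two points that do not depend on `k`.
  have key {k : ℝ → ℝ} (hk : MonotoneOn k s) : overlap (mapFour k ((a, b), c, d)) =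
      max 0 (k (min (max a b) (max c d)) - k (max (min a b) (min c d))) := by
    simp only [overlap, mapFour, Prod.map]
    rw [hk.map_min (hmax ha hb) (hmax hc hd), hk.map_max (hmin ha hb) (hmin hc hd),
      hk.map_max ha hb, hk.map_max hc hd, hk.map_min ha hb, hk.map_min hc hd]
  rw [key hf, key hg]
  have hu := hmin (hmax ha hb) (hmax hc hd)
  have hl := hmax (hmin ha hb) (hmin hc hd)
  rcases le_total (max (min a b) (min c d)) (min (max a b) (max c d)) with hle | hle
  · exact max_le_max_left 0 (h _ hl _ hu hle)
  · have := hf hu hl hle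
    rw [max_eq_left (by linarith)]
    exact le_max_left _ _

/-- The detour through the double difference of `|x|`, which is visibly homogeneous, covers `b < 0`,
where the map reverses order. -/
lemma overlap_mapFour_affine (a b : ℝ) (z : (ℝ × ℝ) × (ℝ × ℝ)) :
    overlap (mapFour (fun x => a + b * x) z) = |b| * overlap z := by
  have h : doubleDiff (fun x => |x|) (mapFour (fun x => a + b * x) z)
      = |b| * doubleDiff (fun x => |x|) z := by
    have e (x y : ℝ) : |a + b * x - (a + b * y)| = |b| * |x - y| := by
      rw [← abs_mul]
      ring_nf
    simp only [doubleDiff, mapFour, Prod.map, e]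
    ring
  have h1 := abs_doubleDiff_abs (mapFour (fun x => a + b * x) z)
  rw [h, abs_mul, abs_abs, abs_doubleDiff_abs] at h1
  linarith

/-! ### Pushforwards of product measures along a.e. measurable maps -/

lemma aemeasurable_prodMap {α β α' β' : Type*} [MeasurableSpace α] [MeasurableSpace β]
    [MeasurableSpace α'] [MeasurableSpace β'] {μ : Measure α} {ν : Measure β} [SFinite μ]
    [SFinite ν] {f : α → α'} {g : β → β'} (hf : AEMeasurable f μ) (hg : AEMeasurable g ν) :
    AEMeasurable (Prod.map f g) (μ.prod ν) :=
  (hf.comp_quasiMeasurePreserving Measure.quasiMeasurePreserving_fst).prodMk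
    (hg.comp_quasiMeasurePreserving Measure.quasiMeasurePreserving_snd)

lemma prod_map_map {α β α' β' : Type*} [MeasurableSpace α] [MeasurableSpace β]
    [MeasurableSpace α'] [MeasurableSpace β'] {μ : Measure α} {ν : Measure β} [SFinite μ]
    [SFinite ν] {f : α → α'} {g : β → β'} (hf : AEMeasurable f μ) (hg : AEMeasurable g ν) :
    (μ.map f).prod (ν.map g) = (μ.prod ν).map (Prod.map f g) := by
  rw [Measure.map_congr hf.ae_eq_mk, Measure.map_congr hg.ae_eq_mk,
    Measure.map_prod_map _ _ hf.measurable_mk hg.measurable_mk]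
  refine Measure.map_congr ?_
  filter_upwards [Measure.quasiMeasurePreserving_fst.ae hf.ae_eq_mk,
    Measure.quasiMeasurePreserving_snd.ae hg.ae_eq_mk] with x h1 h2
  simp [Prod.map, h1, h2]

lemma aemeasurable_mapFour {α : Type*} [MeasurableSpace α] {μ : Measure α} [SFinite μ]
    {f : α → ℝ} (hf : AEMeasurable f μ) :
    AEMeasurable (mapFour f) ((μ.prod μ).prod (μ.prod μ)) :=
  aemeasurable_prodMap (aemeasurable_prodMap hf hf) (aemeasurable_prodMap hf hf)

lemma fourCopies_map (P : Measure ℝ) [SFinite P] {f : ℝ → ℝ} (hf : AEMeasurable f P) :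
    fourCopies (P.map f) = (fourCopies P).map (mapFour f) := by
  rw [fourCopies, prod_map_map hf hf,
    prod_map_map (aemeasurable_prodMap hf hf) (aemeasurable_prodMap hf hf)]
  rfl

/-! ### The regularised identity -/

/-- The distance `|x|` regularised at scale `γ⁻¹`. -/
noncomputable def regAbs (γ x : ℝ) : ℝ := (1 - Real.exp (-γ * |x|)) / γ

lemma regAbs_le_abs {γ : ℝ} (hγ : 0 < γ) (x : ℝ) : regAbs γ x ≤ |x| := by
  rw [regAbs, div_le_iff₀ hγ]
  have := Real.add_one_le_exp (-γ * |x|)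
  linarith

/-- With `u = γ|x|` this is `exp(-u) ≤ 1 / (1 + u) ≤ 1 - u + u²`, the last step because `(1 - u +
u²)(1 + u) = 1 + u³`. -/
lemma abs_sub_regAbs_le {γ : ℝ} (hγ : 0 < γ) (x : ℝ) : |x| - regAbs γ x ≤ γ * x ^ 2 := by
  set u := γ * |x| with hu
  have hu0 : 0 ≤ u := by positivity
  have h1 : Real.exp (-u) ≤ 1 - u + u ^ 2 := by
    have h2 := Real.add_one_le_exp u
    have h3 : Real.exp (-u) * Real.exp u = 1 := by rw [← Real.exp_add]; simp
    have h4 : Real.exp (-u) * (u + 1) ≤ 1 := by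
      calc _ ≤ Real.exp (-u) * Real.exp u := mul_le_mul_of_nonneg_left h2 (Real.exp_pos _).le
        _ = 1 := h3
    have h5 : Real.exp (-u) * (u + 1) ≤ (1 - u + u ^ 2) * (u + 1) := by
      have : 0 ≤ u ^ 3 := by positivity
      linarith [show (1 - u + u ^ 2) * (u + 1) = 1 + u ^ 3 by ring]
    exact le_of_mul_le_mul_right h5 (by positivity)
  have h6 : |x| - γ * x ^ 2 ≤ regAbs γ x := by
    rw [regAbs, le_div_iff₀ hγ, neg_mul, ← hu]
    have : (|x| - γ * x ^ 2) * γ = u - u ^ 2 := by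
      rw [hu, mul_pow, sq_abs]; ring
    linarith
  linarith

lemma continuous_regAbs (γ : ℝ) : Continuous (regAbs γ) := by
  unfold regAbs
  fun_prop

lemma continuous_doubleDiff {κ : ℝ → ℝ} (hκ : Continuous κ) : Continuous (doubleDiff κ) := by
  unfold doubleDiff
  fun_prop

lemma continuous_charCov (P : Measure ℝ) [IsProbabilityMeasure P] :
    Continuous fun p : ℝ × ℝ => charCov P p.1 p.2 := by
  unfold charCov
  fun_prop

lemma norm_charCov_le (P : Measure ℝ) [IsProbabilityMeasure P] (s t : ℝ) : ‖charCov P s t‖ ≤ 2 := by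
  refine (norm_sub_le _ _).trans ?_
  rw [norm_mul]
  have h (x : ℝ) : ‖charFun P x‖ ≤ 1 := norm_charFun_le_one x
  have := mul_le_one₀ (h s) (norm_nonneg _) (h t)
  linarith [h (s + t)]

lemma charCov_zero_left (P : Measure ℝ) [IsProbabilityMeasure P] (t : ℝ) : charCov P 0 t = 0 := by
  simp [charCov]

lemma charCov_zero_right (P : Measure ℝ) [IsProbabilityMeasure P] (s : ℝ) : charCov P s 0 = 0 := by
  simp [charCov]

/-- Regularised form of the representation of the distance variance. -/
lemma lintegral_regularised (P : Measure ℝ) [IsProbabilityMeasure P] {γ : ℝ} (hγ : 0 < γ) :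
    ∫⁻ p : ℝ × ℝ, ENNReal.ofReal
        (‖charCov P p.1 p.2‖ ^ 2 / ((p.1 ^ 2 + γ ^ 2) * (p.2 ^ 2 + γ ^ 2)))
      = ENNReal.ofReal (Real.pi ^ 2 / 4) *
        ∫⁻ z, ENNReal.ofReal (doubleDiff (regAbs γ) z ^ 2) ∂(fourCopies P) := by
  lift γ to NNReal using hγ.le
  have hγ0 : γ ≠ 0 := by exact_mod_cast hγ.ne'
  have hpi := Real.pi_pos
  have hκ := charFun_cauchyMeasure_zero hγ0
  have key := integral_normSq_charCov P (cauchyMeasure 0 γ) hκ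
  -- Here `exp(-γ|x|) = 1 - γ * regAbs γ x`, and double differences kill the constant.
  have hdd (z : (ℝ × ℝ) × (ℝ × ℝ)) : doubleDiff (fun s => Real.exp (-γ * |s|)) z ^ 2
      = γ ^ 2 * doubleDiff (regAbs γ) z ^ 2 := by
    rw [← mul_pow, ← neg_sq]
    congr 1
    simp only [doubleDiff, regAbs]
    field_simp
    ring
  have hb (x : ℝ) : Real.exp (-γ * |x|) ≤ 1 := Real.exp_le_one_iff.2 (by
    have : (0 : ℝ) ≤ γ * |x| := by positivity
    linarith)
  have hb0 (x : ℝ) := (Real.exp_pos (-γ * |x|)).le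
  have key2 := congrArg ENNReal.ofReal key
  rw [ofReal_integral_eq_lintegral_ofReal, ofReal_integral_eq_lintegral_ofReal] at key2
  rotate_left
  · refine Integrable.of_bound
      ((continuous_doubleDiff (by fun_prop)).pow 2).aestronglyMeasurable 4
      (Filter.Eventually.of_forall fun z => ?_)
    rw [Real.norm_of_nonneg (by positivity), ← sq_abs, show (4 : ℝ) = 2 ^ 2 by norm_num]
    refine pow_le_pow_left₀ (abs_nonneg _) (abs_le.2 ?_) 2
    simp only [doubleDiff]
    constructor <;>
    linarith [hb (z.1.1 - z.2.1), hb (z.1.2 - z.2.2), hb (z.1.1 - z.2.2), hb (z.1.2 - z.2.1),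
      hb0 (z.1.1 - z.2.1), hb0 (z.1.2 - z.2.2), hb0 (z.1.1 - z.2.2), hb0 (z.1.2 - z.2.1)]
  · exact Filter.Eventually.of_forall fun z => by positivity
  · refine Integrable.of_bound
      (((continuous_charCov P).norm.pow 2).const_mul 4 |>.aestronglyMeasurable) 16
      (Filter.Eventually.of_forall fun z => ?_)
    rw [Real.norm_of_nonneg (by positivity)]
    have := pow_le_pow_left₀ (norm_nonneg _) (norm_charCov_le P z.1 z.2) 2
    linarith
  · exact Filter.Eventually.of_forall fun z => by positivity
  have hmeas := (continuous_charCov P).measurable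
  rw [cauchyMeasure_of_scale_ne_zero 0 hγ0,
    prod_withDensity (measurable_cauchyPDF 0 γ) (measurable_cauchyPDF 0 γ),
    lintegral_withDensity_eq_lintegral_mul _ (by fun_prop) (by fun_prop)] at key2
  simp_rw [hdd] at key2
  -- The factor `4γ² / π²` is isolated on both sides (here and in `h2`) and cancelled at the end.
  have h1 (p : ℝ × ℝ) : ((fun z : ℝ × ℝ => cauchyPDF 0 γ z.1 * cauchyPDF 0 γ z.2) *
      fun p : ℝ × ℝ => ENNReal.ofReal (4 * ‖charCov P p.1 p.2‖ ^ 2)) p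
      = ENNReal.ofReal (4 * γ ^ 2 / Real.pi ^ 2) * ENNReal.ofReal
        (‖charCov P p.1 p.2‖ ^ 2 / ((p.1 ^ 2 + (γ : ℝ) ^ 2) * (p.2 ^ 2 + (γ : ℝ) ^ 2))) := by
    simp only [Pi.mul_apply, cauchyPDF]
    rw [← ENNReal.ofReal_mul (cauchyPDF_pos 0 hγ0 _).le, ← ENNReal.ofReal_mul
      (mul_nonneg (cauchyPDF_pos 0 hγ0 _).le (cauchyPDF_pos 0 hγ0 _).le),
      ← ENNReal.ofReal_mul (by positivity)]
    congr 1
    have : 0 < p.1 ^ 2 + (γ : ℝ) ^ 2 := by positivity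
    have : 0 < p.2 ^ 2 + (γ : ℝ) ^ 2 := by positivity
    simp only [cauchyPDFReal_def, sub_zero]
    field_simp
  have h2 (z : (ℝ × ℝ) × (ℝ × ℝ)) : ENNReal.ofReal ((γ : ℝ) ^ 2 * doubleDiff (regAbs γ) z ^ 2)
      = ENNReal.ofReal (4 * γ ^ 2 / Real.pi ^ 2) * (ENNReal.ofReal (Real.pi ^ 2 / 4) *
        ENNReal.ofReal (doubleDiff (regAbs γ) z ^ 2)) := by
    rw [← ENNReal.ofReal_mul (by positivity), ← ENNReal.ofReal_mul (by positivity)]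
    congr 1
    field_simp
  simp_rw [h1, h2] at key2
  rw [lintegral_const_mul' _ _ ENNReal.ofReal_ne_top,
    lintegral_const_mul' _ _ ENNReal.ofReal_ne_top,
    lintegral_const_mul' _ _ ENNReal.ofReal_ne_top] at key2
  exact (ENNReal.mul_right_inj (by simp; positivity) ENNReal.ofReal_ne_top).1 key2

/-! ### Removing the regularisation -/

section Limits

open Filter Topology

/-- On the axes the right side is a division by zero, hence `0`; this is why `c` must vanish there.
-/
lemma regularised_weight_le {c γ : ℝ} (hc : 0 ≤ c) {s t : ℝ} (h : s = 0 ∨ t = 0 → c = 0) :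
    c / ((s ^ 2 + γ ^ 2) * (t ^ 2 + γ ^ 2)) ≤ c / (|s| ^ 2 * |t| ^ 2) := by
  by_cases h0 : s = 0 ∨ t = 0
  · simp [h h0]
  · push Not at h0
    obtain ⟨hs, ht⟩ := h0
    rw [sq_abs, sq_abs]
    have := sq_nonneg γ
    gcongr <;> linarith

/-- Fatou over the four copies as `γ → 0`, every regularised weight being at most `1 / (s² t²)`. -/
lemma ofReal_mul_lintegral_doubleDiff_le (P : Measure ℝ) [IsProbabilityMeasure P] :
    ENNReal.ofReal (Real.pi ^ 2 / 4) *
        ∫⁻ z, ENNReal.ofReal (doubleDiff (fun x => |x|) z ^ 2) ∂(fourCopies P)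
      ≤ ∫⁻ p : ℝ × ℝ, ENNReal.ofReal (‖charCov P p.1 p.2‖ ^ 2 / (|p.1| ^ 2 * |p.2| ^ 2)) := by
  have hγ (n : ℕ) : (0 : ℝ) < 1 / ((n : ℝ) + 1) := by positivity
  have hlim : Tendsto (fun n : ℕ => 1 / ((n : ℝ) + 1)) atTop (𝓝 0) :=
    tendsto_one_div_add_atTop_nhds_zero_nat
  have hreg (x : ℝ) : Tendsto (fun n : ℕ => regAbs (1 / ((n : ℝ) + 1)) x) atTop (𝓝 |x|) := by
    refine tendsto_of_tendsto_of_tendsto_of_le_of_le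
      (g := fun n : ℕ => |x| - 1 / ((n : ℝ) + 1) * x ^ 2) ?_ tendsto_const_nhds
      (fun n => ?_) (fun n => regAbs_le_abs (hγ n) x)
    · simpa using (hlim.mul_const (x ^ 2)).const_sub |x|
    · have := abs_sub_regAbs_le (hγ n) x
      simp only
      linarith
  have hmeas (n : ℕ) : Measurable fun z =>
      ENNReal.ofReal (doubleDiff (regAbs (1 / ((n : ℝ) + 1))) z ^ 2) :=
    ((continuous_doubleDiff (continuous_regAbs _)).pow 2).measurable.ennreal_ofReal
  have h1 (z : (ℝ × ℝ) × (ℝ × ℝ)) : ENNReal.ofReal (doubleDiff (fun x => |x|) z ^ 2)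
      = liminf (fun n : ℕ => ENNReal.ofReal (doubleDiff (regAbs (1 / ((n : ℝ) + 1))) z ^ 2))
        atTop := by
    refine (ENNReal.tendsto_ofReal (Tendsto.pow ?_ 2)).liminf_eq.symm
    exact (((hreg _).add (hreg _)).sub (hreg _)).sub (hreg _)
  rw [← lintegral_const_mul' _ _ ENNReal.ofReal_ne_top]
  calc _ = ∫⁻ z, liminf (fun n : ℕ => ENNReal.ofReal (Real.pi ^ 2 / 4) *
          ENNReal.ofReal (doubleDiff (regAbs (1 / ((n : ℝ) + 1))) z ^ 2)) atTop
          ∂(fourCopies P) := by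
        refine lintegral_congr fun z => ?_
        rw [ENNReal.liminf_const_mul_of_ne_top ENNReal.ofReal_ne_top, ← h1]
    _ ≤ liminf (fun n : ℕ => ∫⁻ z, ENNReal.ofReal (Real.pi ^ 2 / 4) *
          ENNReal.ofReal (doubleDiff (regAbs (1 / ((n : ℝ) + 1))) z ^ 2) ∂(fourCopies P))
          atTop := lintegral_liminf_le fun n => (hmeas n).const_mul _
    _ ≤ _ := by
        refine liminf_le_of_le (by isBoundedDefault) fun b hb => ?_
        obtain ⟨n, hn⟩ := hb.exists
        refine hn.trans ?_
        rw [lintegral_const_mul' _ _ ENNReal.ofReal_ne_top, ← lintegral_regularised P (hγ n)]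
        refine lintegral_mono fun p => ENNReal.ofReal_le_ofReal
          (regularised_weight_le (by positivity) ?_)
        rintro (h | h)
        · simp [h, charCov_zero_left]
        · simp [h, charCov_zero_right]

/-- Truncation at level `M`. -/
noncomputable def truncate (M x : ℝ) : ℝ := max (-M) (min x M)

lemma continuous_truncate (M : ℝ) : Continuous (truncate M) := by
  unfold truncate
  fun_prop

lemma monotone_truncate (M : ℝ) : Monotone (truncate M) := fun x y h => by
  unfold truncate
  gcongr

lemma truncate_sub_truncate_le (M : ℝ) {x y : ℝ} (h : x ≤ y) :
    truncate M y - truncate M x ≤ y - x := by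
  unfold truncate
  grind

lemma abs_truncate_le {M : ℝ} (hM : 0 ≤ M) (x : ℝ) : |truncate M x| ≤ M := by
  unfold truncate
  grind

lemma truncate_of_abs_le {M x : ℝ} (h : |x| ≤ M) : truncate M x = x := by
  unfold truncate
  grind

lemma overlap_truncate_le (M : ℝ) (z : (ℝ × ℝ) × (ℝ × ℝ)) :
    overlap (mapFour (truncate M) z) ≤ overlap z :=
  overlap_mapFour_le (s := Set.univ) (g := fun x => x) ((monotone_truncate M).monotoneOn _)
    (monotone_id.monotoneOn _) (fun _ _ _ _ h => truncate_sub_truncate_le M h) z (by simp)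

/-- The choice `γ = M⁻³` makes the regularisation error on differences of size at most `2M` at most
`γ (2M)² = 4 / M`. Four such nonnegative errors, two with each sign, give at most `δ = 8 / M`.
Truncation itself is a contraction and can only shrink the overlap. Finally `2δD ≤ δ(D² + 1)` leaves
a bound that needs no first moment of `D`. -/
lemma doubleDiff_regAbs_truncate_sq_le {M : ℝ} (hM : 0 < M) (z : (ℝ × ℝ) × (ℝ × ℝ)) :
    doubleDiff (regAbs (1 / M ^ 3)) (mapFour (truncate M) z) ^ 2
      ≤ (1 + 8 / M) * doubleDiff (fun x => |x|) z ^ 2 + (8 / M + (8 / M) ^ 2) := by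
  set w := mapFour (truncate M) z with hw
  have hγ : 0 < 1 / M ^ 3 := by positivity
  have hd (x y : ℝ) : 0 ≤ |truncate M x - truncate M y| - regAbs (1 / M ^ 3)
      (truncate M x - truncate M y) ∧ |truncate M x - truncate M y| - regAbs (1 / M ^ 3)
      (truncate M x - truncate M y) ≤ 4 / M := by
    refine ⟨by linarith [regAbs_le_abs hγ (truncate M x - truncate M y)],
      (abs_sub_regAbs_le hγ _).trans ?_⟩
    have h1 : (truncate M x - truncate M y) ^ 2 ≤ (2 * M) ^ 2 := by
      rw [← sq_abs]
      refine pow_le_pow_left₀ (abs_nonneg _) ((abs_sub _ _).trans ?_) 2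
      linarith [abs_truncate_le hM.le x, abs_truncate_le hM.le y]
    calc _ ≤ 1 / M ^ 3 * (2 * M) ^ 2 := by gcongr
      _ = 4 / M := by field_simp; norm_num
  have h1 : |doubleDiff (regAbs (1 / M ^ 3)) w| ≤ |doubleDiff (fun x => |x|) w| + 8 / M := by
    have h2 : |doubleDiff (regAbs (1 / M ^ 3)) w - doubleDiff (fun x => |x|) w| ≤ 8 / M := by
      have a1 := hd z.1.1 z.2.1
      have a2 := hd z.1.2 z.2.2
      have a3 := hd z.1.1 z.2.2
      have a4 := hd z.1.2 z.2.1
      have e : 8 / M = 4 / M + 4 / M := by ring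
      rw [e, abs_le]
      simp only [doubleDiff, hw, mapFour, Prod.map]
      constructor <;> linarith [a1.1, a1.2, a2.1, a2.2, a3.1, a3.2, a4.1, a4.2]
    linarith [abs_sub_abs_le_abs_sub (doubleDiff (regAbs (1 / M ^ 3)) w)
      (doubleDiff (fun x => |x|) w)]
  have h2 : |doubleDiff (fun x => |x|) w| ≤ |doubleDiff (fun x => |x|) z| := by
    rw [abs_doubleDiff_abs, abs_doubleDiff_abs]
    linarith [overlap_truncate_le M z]
  set D := |doubleDiff (fun x => |x|) z| with hD
  set δ := 8 / M with hδ
  have hδ0 : 0 ≤ δ := by positivity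
  calc _ = |doubleDiff (regAbs (1 / M ^ 3)) w| ^ 2 := (sq_abs _).symm
    _ ≤ (D + δ) ^ 2 := pow_le_pow_left₀ (abs_nonneg _) (by linarith) 2
    _ ≤ (1 + δ) * D ^ 2 + (δ + δ ^ 2) := by
        have : 0 ≤ δ * (D - 1) ^ 2 := by positivity
        linarith [show (1 + δ) * D ^ 2 + (δ + δ ^ 2) - (D + δ) ^ 2 = δ * (D - 1) ^ 2 by ring]
    _ = _ := by rw [hD, sq_abs]

lemma tendsto_charFun_truncate (P : Measure ℝ) [IsProbabilityMeasure P] (s : ℝ) :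
    Tendsto (fun n : ℕ => charFun (P.map (truncate ((n : ℝ) + 1))) s) atTop (𝓝 (charFun P s)) := by
  simp_rw [charFun_apply_real]
  have h (n : ℕ) : ∫ x, Complex.exp (s * x * Complex.I) ∂(P.map (truncate ((n : ℝ) + 1)))
      = ∫ x, Complex.exp (s * truncate ((n : ℝ) + 1) x * Complex.I) ∂P :=
    integral_map (continuous_truncate _).aemeasurable (Continuous.aestronglyMeasurable (by fun_prop))
  simp_rw [h]
  refine tendsto_integral_of_dominated_convergence (fun _ => 1) (fun n => ?_)
    (integrable_const _) (fun n => Eventually.of_forall fun x => ?_)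
    (Eventually.of_forall fun x => ?_)
  · have := continuous_truncate ((n : ℝ) + 1)
    exact Continuous.aestronglyMeasurable (by fun_prop)
  · rw [norm_cexp_mul_I]
  · refine tendsto_const_nhds.congr' ?_
    filter_upwards [eventually_ge_atTop ⌈|x|⌉₊] with n hn
    rw [truncate_of_abs_le]
    have := (Nat.le_ceil |x|).trans (Nat.cast_le.2 hn)
    linarith

/-- Fatou over `(s, t)`, along truncated laws whose level `M` grows while `γ = M⁻³` shrinks.
Truncation makes the regularisation error uniformly small, so the bound survives when `X` has no
moments. -/
lemma lintegral_charCov_le (P : Measure ℝ) [IsProbabilityMeasure P] :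
    ∫⁻ p : ℝ × ℝ, ENNReal.ofReal (‖charCov P p.1 p.2‖ ^ 2 / (|p.1| ^ 2 * |p.2| ^ 2))
      ≤ ENNReal.ofReal (Real.pi ^ 2 / 4) *
        ∫⁻ z, ENNReal.ofReal (doubleDiff (fun x => |x|) z ^ 2) ∂(fourCopies P) := by
  set M : ℕ → ℝ := fun n => (n : ℝ) + 1
  have hM (n : ℕ) : 0 < M n := by positivity
  have hMlim : Tendsto M atTop atTop :=
    tendsto_atTop_add_const_right _ _ tendsto_natCast_atTop_atTop
  set Q : ℕ → Measure ℝ := fun n => P.map (truncate (M n))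
  have hQp (n : ℕ) : IsProbabilityMeasure (Q n) :=
    Measure.isProbabilityMeasure_map (continuous_truncate _).aemeasurable
  set E := ∫⁻ z, ENNReal.ofReal (doubleDiff (fun x => |x|) z ^ 2) ∂(fourCopies P) with hE
  set F : ℕ → ℝ × ℝ → ℝ≥0∞ := fun n p => ENNReal.ofReal (‖charCov (Q n) p.1 p.2‖ ^ 2 /
    ((p.1 ^ 2 + (1 / M n ^ 3) ^ 2) * (p.2 ^ 2 + (1 / M n ^ 3) ^ 2))) with hF
  have hFmeas (n : ℕ) : Measurable (F n) := by
    have := (continuous_charCov (Q n)).measurable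
    exact Measurable.ennreal_ofReal (by fun_prop)
  have hGmeas (n : ℕ) : Measurable fun z =>
      ENNReal.ofReal (doubleDiff (regAbs (1 / M n ^ 3)) z ^ 2) :=
    ((continuous_doubleDiff (continuous_regAbs _)).pow 2).measurable.ennreal_ofReal
  have hcov (s t : ℝ) : Tendsto (fun n => charCov (Q n) s t) atTop (𝓝 (charCov P s t)) :=
    (tendsto_charFun_truncate P _).sub
      ((tendsto_charFun_truncate P _).mul (tendsto_charFun_truncate P _))
  have hγlim : Tendsto (fun n => (1 / M n ^ 3) ^ 2) atTop (𝓝 0) := by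
    have : Tendsto (fun n => 1 / M n ^ 3) atTop (𝓝 0) := by
      simp_rw [one_div]
      exact ((tendsto_pow_atTop (by norm_num)).comp hMlim).inv_tendsto_atTop
    simpa using this.pow 2
  have hpt (p : ℝ × ℝ) : ENNReal.ofReal (‖charCov P p.1 p.2‖ ^ 2 / (|p.1| ^ 2 * |p.2| ^ 2))
      ≤ liminf (fun n => F n p) atTop := by
    by_cases h0 : p.1 ^ 2 * p.2 ^ 2 = 0
    · rw [sq_abs, sq_abs, h0]
      simp
    · rw [sq_abs, sq_abs]
      refine (ENNReal.tendsto_ofReal (Tendsto.div ((hcov _ _).norm.pow 2) ?_ h0)).liminf_eq.ge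
      simpa using (hγlim.const_add (p.1 ^ 2)).mul (hγlim.const_add (p.2 ^ 2))
  have hbound (n : ℕ) : ∫⁻ p, F n p ≤ ENNReal.ofReal (Real.pi ^ 2 / 4) *
      (ENNReal.ofReal (1 + 8 / M n) * E + ENNReal.ofReal (8 / M n + (8 / M n) ^ 2)) := by
    have := hM n
    rw [hF, lintegral_regularised (Q n) (by positivity),
      fourCopies_map P (continuous_truncate _).aemeasurable, lintegral_map' (hGmeas n).aemeasurable
        (aemeasurable_mapFour (continuous_truncate _).aemeasurable)]
    gcongr
    calc _ ≤ ∫⁻ z, (ENNReal.ofReal (1 + 8 / M n) *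
          ENNReal.ofReal (doubleDiff (fun x => |x|) z ^ 2)
          + ENNReal.ofReal (8 / M n + (8 / M n) ^ 2)) ∂(fourCopies P) := by
          refine lintegral_mono fun z => ?_
          rw [← ENNReal.ofReal_mul (by positivity), ← ENNReal.ofReal_add (by positivity)
            (by positivity)]
          exact ENNReal.ofReal_le_ofReal (doubleDiff_regAbs_truncate_sq_le (hM n) z)
      _ = _ := by
          rw [lintegral_add_right _ measurable_const,
            lintegral_const_mul' _ _ ENNReal.ofReal_ne_top]
          simp [hE]
  have hδ : Tendsto (fun n => 8 / M n) atTop (𝓝 0) := hMlim.const_div_atTop 8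
  have hlim : Tendsto (fun n => ENNReal.ofReal (Real.pi ^ 2 / 4) *
      (ENNReal.ofReal (1 + 8 / M n) * E + ENNReal.ofReal (8 / M n + (8 / M n) ^ 2))) atTop
      (𝓝 (ENNReal.ofReal (Real.pi ^ 2 / 4) * (ENNReal.ofReal (1 + 0) * E
        + ENNReal.ofReal (0 + 0 ^ 2)))) := by
    -- `E` may be infinite; multiplication by it is still continuous here because the limit `1 + 0`
    -- of the other factor is not zero.
    refine ENNReal.Tendsto.const_mul (Tendsto.add (ENNReal.Tendsto.mul_const
      (ENNReal.tendsto_ofReal (hδ.const_add 1)) (Or.inl ?_))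
      (ENNReal.tendsto_ofReal (hδ.add (hδ.pow 2)))) (Or.inr ENNReal.ofReal_ne_top)
    simp
  calc _ ≤ ∫⁻ p, liminf (fun n => F n p) atTop := lintegral_mono hpt
    _ ≤ liminf (fun n => ∫⁻ p, F n p) atTop := lintegral_liminf_le hFmeas
    _ ≤ _ := liminf_le_liminf (Eventually.of_forall hbound)
    _ = _ := hlim.liminf_eq
    _ = _ := by simp

/-- The distance variance is the mean squared length of the intersection of two independent
intervals spanned by independent copies of the random variable. -/
theorem distVariance_eq_lintegral_overlap {Ω : Type u} [MeasurableSpace Ω] (μ : Measure Ω)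
    [IsProbabilityMeasure μ] {X : Ω → ℝ} (hX : AEMeasurable X μ) :
    distVariance μ X = ∫⁻ z, ENNReal.ofReal (overlap z ^ 2) ∂(fourCopies (μ.map X)) := by
  have := Measure.isProbabilityMeasure_map hX
  have h : ∫⁻ p : ℝ × ℝ, ENNReal.ofReal (‖charCov (μ.map X) p.1 p.2‖ ^ 2
      / (|p.1| ^ 2 * |p.2| ^ 2)) = _ :=
    (lintegral_charCov_le (μ.map X)).antisymm (ofReal_mul_lintegral_doubleDiff_le (μ.map X))
  simp only [charCov] at h
  rw [distVariance, h, ← mul_assoc, ← ENNReal.ofReal_mul (by positivity),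
    ← lintegral_const_mul' _ _ ENNReal.ofReal_ne_top]
  refine lintegral_congr fun z => ?_
  rw [doubleDiff_abs_sq, ← ENNReal.ofReal_mul (by positivity)]
  congr 1
  field_simp

end Limits

/-! ### The quantile transform -/

section Quantile

open Set Filter Topology

lemma nonempty_setOf_lt_cdf (P : Measure ℝ) {α : ℝ} (hα : α < 1) :
    {x : ℝ | α < cdf P x}.Nonempty :=
  ((tendsto_cdf_atTop P).eventually (lt_mem_nhds hα)).exists

lemma bddBelow_setOf_lt_cdf (P : Measure ℝ) {α : ℝ} (hα : 0 < α) :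
    BddBelow {x : ℝ | α < cdf P x} := by
  obtain ⟨y, hy⟩ := ((tendsto_cdf_atBot P).eventually (gt_mem_nhds hα)).exists
  refine ⟨y, fun x hx => ?_⟩
  by_contra! h
  exact absurd (monotone_cdf P h.le) (not_le.2 (hy.trans hx))

lemma monotoneOn_rightContInverse_cdf (P : Measure ℝ) :
    MonotoneOn (rightContInverse (cdf P)) (Ioo 0 1) := fun _ ha _ hb hab =>
  csInf_le_csInf (bddBelow_setOf_lt_cdf P ha.1) (nonempty_setOf_lt_cdf P hb.2)
    fun _ hx => hab.trans_lt hx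

lemma rightContInverse_cdf_le (P : Measure ℝ) {α x : ℝ} (hα : 0 < α) (h : α < cdf P x) :
    rightContInverse (cdf P) α ≤ x :=
  csInf_le (bddBelow_setOf_lt_cdf P hα) h

/-- Every `y > x` has `α < F(y)`; letting `y` decrease to `x`, right-continuity keeps only the weak
inequality. With `rightContInverse_cdf_le` this is an equivalence except at the level `α = F(x)`. -/
lemma le_cdf_of_rightContInverse_le (P : Measure ℝ) {α x : ℝ} (hα : α < 1)
    (h : rightContInverse (cdf P) α ≤ x) : α ≤ cdf P x := by
  have hc : Tendsto (cdf P) (𝓝[>] x) (𝓝 (cdf P x)) :=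
    ((cdf P).right_continuous x).mono Ioi_subset_Ici_self
  refine ge_of_tendsto hc ?_
  filter_upwards [self_mem_nhdsWithin] with y hy
  obtain ⟨z, hz, hzy⟩ := exists_lt_of_csInf_lt (nonempty_setOf_lt_cdf P hα) (h.trans_lt hy)
  exact (lt_of_lt_of_le hz (monotone_cdf P hzy.le)).le

/-- The uniform distribution on the unit interval. -/
noncomputable abbrev uniformUnit : Measure ℝ := volume.restrict (Ioo (0 : ℝ) 1)

lemma aemeasurable_rightContInverse_cdf (P : Measure ℝ) :
    AEMeasurable (rightContInverse (cdf P)) uniformUnit :=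
  aemeasurable_restrict_of_monotoneOn measurableSet_Ioo (monotoneOn_rightContInverse_cdf P)

/-- The quantile transform. -/
lemma map_rightContInverse_cdf (P : Measure ℝ) [IsProbabilityMeasure P] :
    uniformUnit.map (rightContInverse (cdf P)) = P := by
  refine Measure.ext_of_Iic _ _ fun x => ?_
  rw [Measure.map_apply_of_aemeasurable (aemeasurable_rightContInverse_cdf P) measurableSet_Iic]
  have h : rightContInverse (cdf P) ⁻¹' Iic x =ᵐ[uniformUnit] Iio (cdf P x) := by
    -- The one level at which the two implications do not match is a null set.
    have hne : ∀ᵐ u ∂uniformUnit, u ≠ cdf P x :=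
      ae_restrict_of_ae (Measure.ae_ne volume (cdf P x))
    refine eventuallyEq_set.2 ?_
    filter_upwards [hne, ae_restrict_mem measurableSet_Ioo] with u hu hu01
    exact ⟨fun hq => lt_of_le_of_ne (le_cdf_of_rightContInverse_le P hu01.2 hq) hu,
      fun hlt => rightContInverse_cdf_le P hu01.1 hlt⟩
  have hI : Iio (cdf P x) ∩ Ioo 0 1 = Ioo 0 (cdf P x) := by
    ext u
    have := cdf_le_one P x
    simp only [mem_inter_iff, mem_Iio, mem_Ioo]
    exact ⟨fun hu => ⟨hu.2.1, hu.1⟩, fun hu => ⟨hu.2, hu.1, hu.2.trans_le this⟩⟩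
  rw [measure_congr h, Measure.restrict_apply measurableSet_Iio, hI, Real.volume_Ioo, sub_zero,
    ofReal_cdf]

end Quantile

/-! ### Monotonicity, dilation and the main theorem -/

lemma lintegral_overlap_map {P : Measure ℝ} [SFinite P] {f : ℝ → ℝ} (hf : AEMeasurable f P) :
    ∫⁻ z, ENNReal.ofReal (overlap z ^ 2) ∂(fourCopies (P.map f)) =
      ∫⁻ z, ENNReal.ofReal (overlap (mapFour f z) ^ 2) ∂(fourCopies P) := by
  have h : Measurable fun z => ENNReal.ofReal (overlap z ^ 2) :=
    (continuous_overlap.pow 2).measurable.ennreal_ofReal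
  rw [fourCopies_map P hf, lintegral_map' h.aemeasurable (aemeasurable_mapFour hf)]

theorem distVariance_mono_of_dispersiveLE {Ω : Type u} {Ω' : Type v} [MeasurableSpace Ω]
    [MeasurableSpace Ω'] {μ : Measure Ω} {ν : Measure Ω'} [IsProbabilityMeasure μ]
    [IsProbabilityMeasure ν] {X : Ω → ℝ} {Y : Ω' → ℝ} (hX : AEMeasurable X μ)
    (hY : AEMeasurable Y ν) (h : DispersiveLE μ X ν Y) : distVariance μ X ≤ distVariance ν Y := by
  have := Measure.isProbabilityMeasure_map hX
  have := Measure.isProbabilityMeasure_map hY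
  rw [distVariance_eq_lintegral_overlap μ hX, distVariance_eq_lintegral_overlap ν hY,
    ← map_rightContInverse_cdf (μ.map X), ← map_rightContInverse_cdf (ν.map Y),
    lintegral_overlap_map (aemeasurable_rightContInverse_cdf _),
    lintegral_overlap_map (aemeasurable_rightContInverse_cdf _)]
  -- Monotonicity of the quantile functions and the dispersive hypothesis are available only on `(0,
  -- 1)`, so the product law is written as a restriction to the open cube, where almost every point
  -- lies.
  have hU : fourCopies uniformUnit = Measure.restrict (fourCopies volume)
      ((Set.Ioo (0 : ℝ) 1 ×ˢ Set.Ioo (0 : ℝ) 1) ×ˢ (Set.Ioo (0 : ℝ) 1 ×ˢ Set.Ioo (0 : ℝ) 1)) := by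
    rw [fourCopies, Measure.prod_restrict, Measure.prod_restrict]
  refine lintegral_mono_ae ?_
  rw [hU]
  filter_upwards [ae_restrict_mem ((measurableSet_Ioo.prod measurableSet_Ioo).prod
    (measurableSet_Ioo.prod measurableSet_Ioo))] with z hz
  exact ENNReal.ofReal_le_ofReal (pow_le_pow_left₀ (overlap_nonneg _)
    (overlap_mapFour_le (monotoneOn_rightContInverse_cdf _) (monotoneOn_rightContInverse_cdf _)
      (fun a ha b hb hab => h a b ha.1 hab hb.2) z hz) 2)

theorem distStdDev_mono_of_dispersiveLE {Ω : Type u} {Ω' : Type v} [MeasurableSpace Ω]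
    [MeasurableSpace Ω'] {μ : Measure Ω} {ν : Measure Ω'} [IsProbabilityMeasure μ]
    [IsProbabilityMeasure ν] {X : Ω → ℝ} {Y : Ω' → ℝ} (hX : AEMeasurable X μ)
    (hY : AEMeasurable Y ν) (h : DispersiveLE μ X ν Y) : distStdDev μ X ≤ distStdDev ν Y :=
  ENNReal.rpow_le_rpow (distVariance_mono_of_dispersiveLE hX hY h) (by norm_num)

/-- Since the overlap formula holds in `[0, ∞]`, the case `b = 0` with infinite distance variance
needs no separate treatment. -/
theorem distStdDev_add_mul {Ω : Type u} [MeasurableSpace Ω] (μ : Measure Ω)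
    [IsProbabilityMeasure μ] {X : Ω → ℝ} (hX : AEMeasurable X μ) (a b : ℝ) :
    distStdDev μ (fun ω => a + b * X ω) = ENNReal.ofReal |b| * distStdDev μ X := by
  have := Measure.isProbabilityMeasure_map hX
  have hf : Measurable fun x : ℝ => a + b * x := by fun_prop
  have hmap : μ.map (fun ω => a + b * X ω) = (μ.map X).map (fun x => a + b * x) :=
    (AEMeasurable.map_map_of_aemeasurable hf.aemeasurable hX).symm
  have hvar : distVariance μ (fun ω => a + b * X ω)
      = ENNReal.ofReal |b| ^ (2 : ℝ) * distVariance μ X := by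
    have hcomp : AEMeasurable (fun ω => a + b * X ω) μ := hf.comp_aemeasurable hX
    rw [distVariance_eq_lintegral_overlap μ hcomp, hmap,
      lintegral_overlap_map hf.aemeasurable, distVariance_eq_lintegral_overlap μ hX,
      ENNReal.ofReal_rpow_of_nonneg (abs_nonneg b) (by norm_num),
      ← lintegral_const_mul' _ _ ENNReal.ofReal_ne_top]
    refine lintegral_congr fun z => ?_
    rw [overlap_mapFour_affine, mul_pow, ENNReal.ofReal_mul (by positivity), Real.rpow_two]
  rw [distStdDev, hvar, ENNReal.mul_rpow_of_nonneg _ _ (by norm_num), ← ENNReal.rpow_mul,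
    distStdDev]
  norm_num

theorem mainTheorem1 :
    (∀ (Ω : Type u) (Ω' : Type v) [MeasurableSpace Ω] [MeasurableSpace Ω']
      (μ : Measure Ω) (ν : Measure Ω') [IsProbabilityMeasure μ] [IsProbabilityMeasure ν]
      (X : Ω → ℝ) (Y : Ω' → ℝ), AEMeasurable X μ → AEMeasurable Y ν →
        DispersiveLE μ X ν Y → distStdDev μ X ≤ distStdDev ν Y) ∧
    IsMeasureOfSpread.{u} (fun _ _ μ X => ((distStdDev μ X : ℝ≥0∞) : EReal)) := by
  refine ⟨fun _ _ _ _ _ _ _ _ _ _ => distStdDev_mono_of_dispersiveLE,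
    fun _ _ _ _ _ _ => EReal.coe_ennreal_nonneg _, ?_, ?_⟩
  · intro Ω _ μ _ X hX a b
    rw [distStdDev_add_mul μ hX, EReal.coe_ennreal_mul, EReal.coe_ennreal_ofReal,
      max_eq_left (abs_nonneg b)]
  · intro Ω Ω' _ _ μ ν _ _ X Y hX hY h
    exact EReal.coe_ennreal_le_coe_ennreal_iff.2 (distStdDev_mono_of_dispersiveLE hX hY h)
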